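/- Let $A$ and $B$ be real $N\times N$ matrices, with $A$ symmetric and non-negative definite, and put $$E(t)=e^{-tB}\quad (t\in\mathbb{R}),\qquad C(t)=\int_0^t E(s)\,A\,E(s)^T\,ds\quad (t>0).$$ Assume that $C(t)$ is positive definite for every $t>0$ (equivalently, that the Ornstein--Uhlenbeck operator $\mathcal{L}=\operatorname{tr}(AD^2)+\langle Bx,D\rangle$ is hypoelliptic), and that every complex eigenvalue of $B$ is purely imaginary, that is, $\sigma(B)\subseteq i\mathbb{R}$ (the eigenvalue $0$ is allowed). Then there exist constants $c_+,c_->0$ such that, for every $t\ge 1$, $$\langle E(-t)\,C(t)\,E(-t)^T\xi,\xi\rangle\ \ge\ c_+\,t\,|\xi|^2\qquad\text{for all }\xi\in\mathbb{R}^N$$ and $$\langle C(t)\,\xi,\xi\rangle\ \ge\ c_-\,t\,|\xi|^2\qquad\text{for all }\xi\in\mathbb{R}^N .$$ Here $\langle\cdot,\cdot\rangle$ and $|\cdot|$ are the Euclidean inner product and norm. -/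

import Mathlib

noncomputable section

namespace OrnsteinUhlenbeck

/-- The exponential matrix `E(t) = exp(-tB)`. -/
def E {N : ℕ} (B : Matrix (Fin N) (Fin N) ℝ) (t : ℝ) : Matrix (Fin N) (Fin N) ℝ :=
  NormedSpace.exp ((-t) • B)

/-- The Kalman matrix `C(t) = ∫₀ᵗ E(s) A E(s)ᵀ ds`; the integral of a matrix-valued
function is taken entry by entry. -/
def C {N : ℕ} (A B : Matrix (Fin N) (Fin N) ℝ) (t : ℝ) : Matrix (Fin N) (Fin N) ℝ :=
  Matrix.of fun i j => ∫ s in (0 : ℝ)..t, (E B s * A * (E B s).transpose) i j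

/-- The set of (complex) eigenvalues of the real matrix `B`. -/
def sigma {N : ℕ} (B : Matrix (Fin N) (Fin N) ℝ) : Set ℂ :=
  spectrum ℂ (B.map (fun x : ℝ => (x : ℂ)))

/-- The quadratic form `⟨Mξ, ξ⟩` on `ℝᴺ` with its Euclidean inner product. -/
def quadForm {N : ℕ} (M : Matrix (Fin N) (Fin N) ℝ) (ξ : EuclideanSpace ℝ (Fin N)) : ℝ :=
  inner ℝ (Matrix.toEuclideanLin M ξ) ξ

end OrnsteinUhlenbeck

end

noncomputable section

namespace OrnsteinUhlenbeck

open Polynomial Matrix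

/-! The matrix `T = E(q)ᵀ` has all its eigenvalues on the unit circle, for every `q`. Hence its
characteristic polynomial has constant term of modulus one and coefficients bounded by `2 ^ N`, and
Cayley–Hamilton controls `ξ` by `T ξ, ..., T ^ N ξ` with a constant independent of `q`
(`norm_sq_le_sum_orbit`), although `E(q)` itself may grow polynomially. Averaging over `q` bounds `n
‖ξ‖²` by the sum of `‖E(k)ᵀ ξ‖²` over `k < n` (`natCast_mul_le_sum_range`). Coercivity of `C(1)` on
each unit time interval turns this into linear growth of `C(t)`. The conjugated form is the Kalman
form of `-B`, so the same argument covers it. -/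

/-! ### Spectrum of the exponential and Cayley–Hamilton -/

lemma exp_mulVec_of_mulVec_eq_smul {n : Type*} [Fintype n] [DecidableEq n]
    {M : Matrix n n ℂ} {v : n → ℂ} {z : ℂ} (h : M *ᵥ v = z • v) :
    NormedSpace.exp M *ᵥ v = Complex.exp z • v := by
  have hpow : ∀ k : ℕ, (M ^ k) *ᵥ v = z ^ k • v := by
    intro k
    induction k with
    | zero => simp
    | succ k ih => rw [pow_succ, ← mulVec_mulVec, h, mulVec_smul, ih, smul_smul, pow_succ, mul_comm]
  open scoped Norms.Operator in
  have h1 : HasSum (fun k : ℕ => ((k.factorial : ℂ)⁻¹) • M ^ k) (NormedSpace.exp M) :=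
    NormedSpace.exp_series_hasSum_exp' (𝕂 := ℂ) M
  have hcont : Continuous fun X : Matrix n n ℂ => X *ᵥ v := by fun_prop
  have h2 := h1.map (AddMonoidHom.mk' (fun X : Matrix n n ℂ => X *ᵥ v)
    (fun X Y => add_mulVec X Y v)) hcont
  have h3 : HasSum (fun k : ℕ => ((k.factorial : ℂ)⁻¹) • z ^ k) (NormedSpace.exp z) :=
    NormedSpace.exp_series_hasSum_exp' (𝕂 := ℂ) z
  have h4 := h3.smul_const v
  rw [Complex.exp_eq_exp_ℂ]
  refine h2.unique ?_
  convert! h4 using 2 with k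
  simp [smul_mulVec, hpow, smul_smul]

/-- The spectrum of `exp M` consists of exponentials of spectral values of `M`. -/
lemma spectrum_exp_subset {n : Type*} [Fintype n] [DecidableEq n] (M : Matrix n n ℂ) :
    spectrum ℂ (NormedSpace.exp M) ⊆ Complex.exp '' spectrum ℂ M := by
  intro μ hμ
  -- Finite-dimensional subalgebras are closed, so `exp M` is a polynomial in `M` and polynomial
  -- spectral mapping applies.
  have hmem : NormedSpace.exp M ∈ Algebra.adjoin ℂ {M} := by
    refine NormedSpace.exp_mem (s := Algebra.adjoin ℂ {M}) ?_ (Algebra.self_mem_adjoin_singleton ℂ M)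
    exact (Subalgebra.toSubmodule (Algebra.adjoin ℂ {M})).closed_of_finiteDimensional
  rw [Algebra.adjoin_singleton_eq_range_aeval] at hmem
  obtain ⟨p, hp⟩ := hmem
  have hp : aeval M p = NormedSpace.exp M := hp
  rcases isEmpty_or_nonempty n with hn | hn
  · simp at hμ
  rw [← hp, spectrum.map_polynomial_aeval_of_nonempty M p (spectrum.nonempty_of_isAlgClosed_of_finiteDimensional ℂ M)] at hμ
  obtain ⟨z, hz, rfl⟩ := hμ
  refine ⟨z, hz, ?_⟩
  have hz' := hz
  rw [← Matrix.spectrum_toLin', ← Module.End.hasEigenvalue_iff_mem_spectrum] at hz'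
  obtain ⟨v, hv⟩ := hz'.exists_hasEigenvector
  have hMv : M *ᵥ v = z • v := by simpa using hv.apply_eq_smul
  have h1 := Module.End.aeval_apply_of_hasEigenvector (p := p) hv
  have h2 : aeval (toLin' M) p = toLin' (aeval M p) :=
    (Polynomial.aeval_algHom_apply (Matrix.toLinAlgEquiv' : Matrix n n ℂ ≃ₐ[ℂ] _).toAlgHom M p)
  rw [h2, hp, toLin'_apply, exp_mulVec_of_mulVec_eq_smul hMv] at h1
  exact smul_left_injective ℂ hv.2 h1

lemma norm_eq_one_of_mem_spectrum_exp {N : ℕ} {M : Matrix (Fin N) (Fin N) ℝ}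
    (hM : ∀ z ∈ sigma M, z.re = 0) {μ : ℂ} (hμ : μ ∈ sigma (NormedSpace.exp M)) : ‖μ‖ = 1 := by
  have h : (NormedSpace.exp M).map (fun x : ℝ => (x : ℂ)) =
      NormedSpace.exp (M.map (fun x : ℝ => (x : ℂ))) := by
    open scoped Norms.Operator in
    exact NormedSpace.map_exp (Complex.ofRealHom.mapMatrix (m := Fin N))
      (continuous_id.matrix_map Complex.continuous_ofReal) M
  rw [sigma, h] at hμ
  obtain ⟨z, hz, rfl⟩ := spectrum_exp_subset _ hμ
  rw [Complex.norm_exp, hM z hz, Real.exp_zero]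

/-- Up to sign, the coefficients are elementary symmetric functions of `N` unimodular roots, hence
at most a binomial coefficient in modulus. -/
lemma abs_coeff_charpoly_le {N : ℕ} {T : Matrix (Fin N) (Fin N) ℝ}
    (hT : ∀ z ∈ sigma T, ‖z‖ = 1) :
    |T.charpoly.coeff 0| = 1 ∧ ∀ i, |T.charpoly.coeff i| ≤ 2 ^ N := by
  have hroots : ∀ z ∈ (T.charpoly.map Complex.ofRealHom).roots, ‖z‖ = 1 := by
    intro z hz
    refine hT z ?_
    rw [sigma, Matrix.mem_spectrum_iff_isRoot_charpoly]
    have : T.map (fun x : ℝ => (x : ℂ)) = T.map Complex.ofRealHom := rfl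
    rw [this, Matrix.charpoly_map]
    exact isRoot_of_mem_roots hz
  have hs : (T.charpoly.map Complex.ofRealHom).Splits := IsAlgClosed.splits _
  have hnorm : ∀ i, ‖(T.charpoly.map Complex.ofRealHom).coeff i‖ = |T.charpoly.coeff i| := by
    intro i; simp
  refine ⟨?_, fun i => ?_⟩
  · rw [← hnorm, hs.coeff_zero_eq_prod_roots_of_monic (T.charpoly_monic.map _), norm_mul, norm_pow,
      norm_neg, norm_one, one_pow, one_mul]
    have := map_multiset_prod (normHom (α := ℂ)) (T.charpoly.map Complex.ofRealHom).roots
    refine this.trans (Multiset.prod_eq_one ?_)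
    intro x hx
    obtain ⟨z, hz, rfl⟩ := Multiset.mem_map.1 hx
    exact hroots z hz
  · rw [← hnorm]
    refine (coeff_le_of_roots_le i T.charpoly_monic hs (fun z hz => (hroots z hz).le)).trans ?_
    rw [one_pow, one_mul, Matrix.charpoly_natDegree_eq_dim, Fintype.card_fin]
    exact_mod_cast Nat.choose_le_two_pow N i

/-- A vector is controlled by its forward orbit when the spectrum lies on the unit circle. -/
lemma norm_sq_le_sum_orbit {N : ℕ} {T : Matrix (Fin N) (Fin N) ℝ}
    (hT : ∀ z ∈ sigma T, ‖z‖ = 1) (ξ : EuclideanSpace ℝ (Fin N)) :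
    ‖ξ‖ ^ 2 ≤ (2 ^ N) ^ 2 * N *
      ∑ j ∈ Finset.range N, ‖Matrix.toEuclideanLin (T ^ (j + 1)) ξ‖ ^ 2 := by
  obtain ⟨h0, hc⟩ := abs_coeff_charpoly_le hT
  have hCH := T.aeval_self_charpoly
  rw [aeval_eq_sum_range, Matrix.charpoly_natDegree_eq_dim, Fintype.card_fin,
    Finset.sum_range_succ', pow_zero] at hCH
  have hξ := congrArg (fun X => Matrix.toEuclideanLin X ξ) hCH
  simp only [map_add, map_sum, map_smul, map_zero, LinearMap.add_apply, LinearMap.sum_apply,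
    LinearMap.smul_apply, LinearMap.zero_apply, toLpLin_one, LinearMap.id_apply] at hξ
  have h1 : ‖ξ‖ = ‖∑ j ∈ Finset.range N,
      T.charpoly.coeff (j + 1) • Matrix.toEuclideanLin (T ^ (j + 1)) ξ‖ := by
    rw [eq_neg_of_add_eq_zero_left hξ, norm_neg, norm_smul, Real.norm_eq_abs, h0, one_mul]
  have h2 : ‖ξ‖ ≤ 2 ^ N * ∑ j ∈ Finset.range N, ‖Matrix.toEuclideanLin (T ^ (j + 1)) ξ‖ := by
    rw [h1, Finset.mul_sum]
    refine (norm_sum_le _ _).trans (Finset.sum_le_sum fun j _ => ?_)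
    rw [norm_smul, Real.norm_eq_abs]
    gcongr
    exact hc _
  calc ‖ξ‖ ^ 2 ≤ (2 ^ N * ∑ j ∈ Finset.range N, ‖Matrix.toEuclideanLin (T ^ (j + 1)) ξ‖) ^ 2 := by
        gcongr
    _ ≤ _ := by
      rw [mul_pow, mul_assoc]
      gcongr
      simpa using sq_sum_le_card_mul_sum_sq (s := Finset.range N)
        (f := fun j => ‖Matrix.toEuclideanLin (T ^ (j + 1)) ξ‖)

/-! ### Averaging over arithmetic progressions -/

/-- Averaging an estimate by arithmetic progressions gives a linear lower bound for
partial sums. -/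
lemma natCast_mul_le_sum_range {F : ℕ → ℝ} (hF : ∀ k, 0 ≤ F k) {K : ℝ} (hK : 0 ≤ K) {d : ℕ}
    (hd : 0 < d) (h : ∀ q, F 0 ≤ K * ∑ j ∈ Finset.range d, F ((j + 1) * q)) (n : ℕ) :
    n * F 0 ≤ d * (K * d + 1) * ∑ k ∈ Finset.range n, F k := by
  rcases Nat.eq_zero_or_pos n with rfl | hn
  · simp
  set S := ∑ k ∈ Finset.range n, F k
  have hS : 0 ≤ S := Finset.sum_nonneg fun k _ => hF k
  have hFS : F 0 ≤ S :=
    Finset.single_le_sum (f := F) (fun k _ => hF k) (Finset.mem_range.2 hn)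
  set m := (n - 1) / d
  -- `m` is the largest number of steps `q = 1, ..., m` for which every index `(j + 1) * q` with `j
  -- < d` stays below `n`.
  have hmn : d * m ≤ n - 1 := Nat.mul_div_le _ _
  have hnm : n ≤ d * (m + 1) := by
    have := Nat.lt_mul_div_succ (n - 1) hd
    change n - 1 < d * (m + 1) at this
    omega
  have hprog : ∀ j ∈ Finset.range d, ∑ i ∈ Finset.range m, F ((j + 1) * (i + 1)) ≤ S := by
    intro j hj
    have hinj : Set.InjOn (fun i => (j + 1) * (i + 1)) (Finset.range m : Set ℕ) := by
      intro a _ b _ hab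
      simpa using hab
    rw [← Finset.sum_image (g := fun i => (j + 1) * (i + 1)) (f := F) hinj]
    refine Finset.sum_le_sum_of_subset_of_nonneg ?_ fun k _ _ => hF k
    intro k hk
    obtain ⟨i, hi, rfl⟩ := Finset.mem_image.1 hk
    rw [Finset.mem_range] at hi hj ⊢
    have : (j + 1) * (i + 1) ≤ d * m := Nat.mul_le_mul hj hi
    omega
  have hm : m * F 0 ≤ K * (d * S) := by
    calc (m : ℝ) * F 0 = ∑ i ∈ Finset.range m, F 0 := by simp
      _ ≤ ∑ i ∈ Finset.range m, K * ∑ j ∈ Finset.range d, F ((j + 1) * (i + 1)) :=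
        Finset.sum_le_sum fun i _ => h (i + 1)
      _ = K * ∑ j ∈ Finset.range d, ∑ i ∈ Finset.range m, F ((j + 1) * (i + 1)) := by
        rw [← Finset.mul_sum, Finset.sum_comm]
      _ ≤ K * ∑ j ∈ Finset.range d, S := by
        gcongr with j hj
        exact hprog j hj
      _ = K * (d * S) := by simp
  calc (n : ℝ) * F 0 ≤ (d * (m + 1) : ℝ) * F 0 := by
        gcongr
        · exact hF 0
        · exact_mod_cast hnm
    _ = d * (m * F 0 + F 0) := by ring
    _ ≤ d * (K * (d * S) + S) := by gcongr
    _ = d * (K * d + 1) * S := by ring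

/-! ### The exponential matrix and quadratic forms -/

variable {N : ℕ}

lemma E_add (B : Matrix (Fin N) (Fin N) ℝ) (s t : ℝ) : E B (s + t) = E B s * E B t := by
  rw [E, E, E, ← Matrix.exp_add_of_commute, neg_add, add_smul]
  exact ((Commute.refl B).smul_left _).smul_right _

lemma E_zero (B : Matrix (Fin N) (Fin N) ℝ) : E B 0 = 1 := by
  simp [E]

lemma E_neg_left (B : Matrix (Fin N) (Fin N) ℝ) (t : ℝ) : E (-B) t = E B (-t) := by
  simp [E]

lemma E_natCast_mul (B : Matrix (Fin N) (Fin N) ℝ) (k : ℕ) (t : ℝ) :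
    E B (k * t) = E B t ^ k := by
  rw [E, E, ← Matrix.exp_nsmul, ← Nat.cast_smul_eq_nsmul ℝ, smul_smul, mul_neg]

lemma continuous_E (B : Matrix (Fin N) (Fin N) ℝ) : Continuous (E B) := by
  open scoped Norms.Operator in
  have h : Continuous (NormedSpace.exp : Matrix (Fin N) (Fin N) ℝ → _) :=
    NormedSpace.exp_continuous
  exact h.comp (by fun_prop)

lemma quadForm_eq_dotProduct (M : Matrix (Fin N) (Fin N) ℝ) (ξ : EuclideanSpace ℝ (Fin N)) :
    quadForm M ξ = ξ.ofLp ⬝ᵥ M *ᵥ ξ.ofLp := by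
  rw [quadForm, real_inner_comm]
  exact inner_toEuclideanCLM M ξ ξ

lemma quadForm_eq_sum (M : Matrix (Fin N) (Fin N) ℝ) (ξ : EuclideanSpace ℝ (Fin N)) :
    quadForm M ξ = ∑ i, ∑ j, ξ i * ξ j * M i j := by
  simp only [quadForm_eq_dotProduct, dotProduct, mulVec, Finset.mul_sum]
  exact Finset.sum_congr rfl fun i _ => Finset.sum_congr rfl fun j _ => by ring

lemma continuous_quadForm (M : Matrix (Fin N) (Fin N) ℝ) : Continuous (quadForm M) := by
  have : quadForm M = fun ξ => ∑ i, ∑ j, ξ i * ξ j * M i j := funext (quadForm_eq_sum M)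
  rw [this]
  fun_prop

lemma quadForm_conj (P M : Matrix (Fin N) (Fin N) ℝ) (ξ : EuclideanSpace ℝ (Fin N)) :
    quadForm (P * M * Pᵀ) ξ = quadForm M (Matrix.toEuclideanLin Pᵀ ξ) := by
  rw [quadForm_eq_dotProduct, quadForm_eq_dotProduct, ← mulVec_mulVec, ← mulVec_mulVec,
    dotProduct_mulVec, ← mulVec_transpose]
  rfl

lemma quadForm_smul (M : Matrix (Fin N) (Fin N) ℝ) (a : ℝ) (ξ : EuclideanSpace ℝ (Fin N)) :
    quadForm M (a • ξ) = a ^ 2 * quadForm M ξ := by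
  simp only [quadForm_eq_sum, Finset.mul_sum, PiLp.smul_apply, smul_eq_mul]
  exact Finset.sum_congr rfl fun i _ => Finset.sum_congr rfl fun j _ => by ring

lemma quadForm_nonneg {M : Matrix (Fin N) (Fin N) ℝ} (hM : M.PosSemidef)
    (ξ : EuclideanSpace ℝ (Fin N)) : 0 ≤ quadForm M ξ := by
  rw [quadForm_eq_dotProduct]
  simpa using hM.dotProduct_mulVec_nonneg ξ.ofLp

lemma quadForm_pos {M : Matrix (Fin N) (Fin N) ℝ} (hM : M.PosDef)
    {ξ : EuclideanSpace ℝ (Fin N)} (hξ : ξ ≠ 0) : 0 < quadForm M ξ := by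
  rw [quadForm_eq_dotProduct]
  simpa using hM.dotProduct_mulVec_pos (x := ξ.ofLp) (by simpa using hξ)

/-- A positive quadratic form on a finite-dimensional space is coercive. -/
lemma exists_le_quadForm {M : Matrix (Fin N) (Fin N) ℝ} (hM : ∀ ξ ≠ 0, 0 < quadForm M ξ) :
    ∃ c : ℝ, 0 < c ∧ ∀ ξ, c * ‖ξ‖ ^ 2 ≤ quadForm M ξ := by
  rcases (Metric.sphere (0 : EuclideanSpace ℝ (Fin N)) 1).eq_empty_or_nonempty with he | hne
  · refine ⟨1, one_pos, fun ξ => ?_⟩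
    have hξ : ξ = 0 := by
      by_contra hξ
      have : (‖ξ‖⁻¹ • ξ) ∈ Metric.sphere (0 : EuclideanSpace ℝ (Fin N)) 1 := by
        simp [norm_smul, norm_ne_zero_iff.2 hξ]
      simp [he] at this
    simp [hξ, quadForm]
  obtain ⟨η, hη, hmin⟩ := (isCompact_sphere (0 : EuclideanSpace ℝ (Fin N)) 1).exists_isMinOn hne
    (continuous_quadForm M).continuousOn
  have hη1 : ‖η‖ = 1 := by simpa using hη
  refine ⟨quadForm M η, hM η (norm_ne_zero_iff.1 (by simp [hη1])), fun ξ => ?_⟩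
  rcases eq_or_ne ξ 0 with rfl | hξ
  · simp [quadForm]
  have h0 : ‖ξ‖ ≠ 0 := norm_ne_zero_iff.2 hξ
  have hmem : (‖ξ‖⁻¹ • ξ) ∈ Metric.sphere (0 : EuclideanSpace ℝ (Fin N)) 1 := by
    simp [norm_smul, h0]
  have h : quadForm M η ≤ quadForm M (‖ξ‖⁻¹ • ξ) := hmin hmem
  calc quadForm M η * ‖ξ‖ ^ 2 ≤ quadForm M (‖ξ‖⁻¹ • ξ) * ‖ξ‖ ^ 2 := by gcongr
    _ = quadForm M ξ := by rw [quadForm_smul]; field_simp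

/-! ### Orbits and the Kalman form -/

/-- The orbit `E(s)ᵀ ξ`. -/
def orbit (B : Matrix (Fin N) (Fin N) ℝ) (ξ : EuclideanSpace ℝ (Fin N)) (s : ℝ) :
    EuclideanSpace ℝ (Fin N) :=
  Matrix.toEuclideanLin (E B s)ᵀ ξ

lemma orbit_zero (B : Matrix (Fin N) (Fin N) ℝ) (ξ : EuclideanSpace ℝ (Fin N)) :
    orbit B ξ 0 = ξ := by
  simp [orbit, E_zero]

lemma orbit_orbit (B : Matrix (Fin N) (Fin N) ℝ) (ξ : EuclideanSpace ℝ (Fin N)) (s t : ℝ) :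
    orbit B (orbit B ξ s) t = orbit B ξ (s + t) := by
  simp only [orbit, E_add, transpose_mul]
  change WithLp.toLp 2 ((E B t)ᵀ *ᵥ ((E B s)ᵀ *ᵥ ξ.ofLp)) =
    WithLp.toLp 2 (((E B t)ᵀ * (E B s)ᵀ) *ᵥ ξ.ofLp)
  rw [mulVec_mulVec]

lemma quadForm_orbit (A B : Matrix (Fin N) (Fin N) ℝ) (ξ : EuclideanSpace ℝ (Fin N)) (s : ℝ) :
    quadForm A (orbit B ξ s) = ∑ i, ∑ j, ξ i * ξ j * (E B s * A * (E B s)ᵀ) i j := by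
  rw [orbit, ← quadForm_conj, quadForm_eq_sum]

lemma continuous_conj_E (A B : Matrix (Fin N) (Fin N) ℝ) :
    Continuous fun s => E B s * A * (E B s)ᵀ :=
  ((continuous_E B).matrix_mul continuous_const).matrix_mul (continuous_E B).matrix_transpose

lemma continuous_quadForm_orbit (A B : Matrix (Fin N) (Fin N) ℝ)
    (ξ : EuclideanSpace ℝ (Fin N)) : Continuous fun s => quadForm A (orbit B ξ s) := by
  simp only [quadForm_orbit]
  exact continuous_finsetSum _ fun i _ => continuous_finsetSum _ fun j _ =>
    continuous_const.mul ((continuous_conj_E A B).matrix_elem i j)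

lemma quadForm_C (A B : Matrix (Fin N) (Fin N) ℝ) (t : ℝ) (ξ : EuclideanSpace ℝ (Fin N)) :
    quadForm (C A B t) ξ = ∫ s in (0 : ℝ)..t, quadForm A (orbit B ξ s) := by
  have hcont : ∀ i j, Continuous fun s => ξ i * ξ j * (E B s * A * (E B s)ᵀ) i j := fun i j =>
    continuous_const.mul ((continuous_conj_E A B).matrix_elem i j)
  simp only [quadForm_orbit]
  rw [quadForm_eq_sum, intervalIntegral.integral_finsetSum fun i _ =>
    (continuous_finsetSum _ fun j _ => hcont i j).intervalIntegrable _ _]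
  refine Finset.sum_congr rfl fun i _ => ?_
  rw [intervalIntegral.integral_finsetSum fun j _ => (hcont i j).intervalIntegrable _ _]
  refine Finset.sum_congr rfl fun j _ => ?_
  rw [intervalIntegral.integral_const_mul]
  rfl

/-- The conjugated Kalman matrix has the quadratic form of the Kalman matrix of `-B`. -/
lemma quadForm_conj_C (A B : Matrix (Fin N) (Fin N) ℝ) (t : ℝ) (ξ : EuclideanSpace ℝ (Fin N)) :
    quadForm (E B (-t) * C A B t * (E B (-t))ᵀ) ξ = quadForm (C A (-B) t) ξ := by
  rw [quadForm_conj, quadForm_C, quadForm_C]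
  change ∫ s in (0 : ℝ)..t, quadForm A (orbit B (orbit B ξ (-t)) s) = _
  have h : ∀ s, orbit (-B) ξ s = orbit B ξ (-s) := fun s => by rw [orbit, orbit, E_neg_left]
  simp only [orbit_orbit, h]
  -- Substitution `s ↦ t - s`.
  have := intervalIntegral.integral_comp_sub_left (a := 0) (b := t)
    (fun s => quadForm A (orbit B ξ (-s))) t
  simpa [sub_eq_add_neg, add_comm] using this

/-! ### Linear growth -/

lemma sigma_smul_re {M : Matrix (Fin N) (Fin N) ℝ} (hM : ∀ z ∈ sigma M, z.re = 0) (a : ℝ) :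
    ∀ z ∈ sigma (a • M), z.re = 0 := by
  intro z hz
  have h : (a • M).map (fun x : ℝ => (x : ℂ)) = (a : ℂ) • M.map (fun x : ℝ => (x : ℂ)) := by
    ext; simp
  rw [sigma, h] at hz
  rcases isEmpty_or_nonempty (Fin N) with hn | hn
  · simp at hz
  rw [spectrum.smul_eq_smul _ _ (spectrum.nonempty_of_isAlgClosed_of_finiteDimensional ℂ _)] at hz
  obtain ⟨w, hw, rfl⟩ := hz
  simp [hM w hw]

lemma sigma_transpose (M : Matrix (Fin N) (Fin N) ℝ) : sigma Mᵀ = sigma M := by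
  ext z
  rw [sigma, sigma, transpose_map, mem_spectrum_iff_isRoot_charpoly,
    mem_spectrum_iff_isRoot_charpoly, charpoly_transpose]

lemma norm_sq_le_sum_orbit_natCast {B : Matrix (Fin N) (Fin N) ℝ}
    (hB : ∀ z ∈ sigma B, z.re = 0) (ξ : EuclideanSpace ℝ (Fin N)) (q : ℕ) :
    ‖ξ‖ ^ 2 ≤ (2 ^ N) ^ 2 * N *
      ∑ j ∈ Finset.range N, ‖orbit B ξ (((j + 1) * q : ℕ) : ℝ)‖ ^ 2 := by
  have h := norm_sq_le_sum_orbit (T := (E B q)ᵀ) (fun z hz => by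
    rw [sigma_transpose] at hz
    exact norm_eq_one_of_mem_spectrum_exp (sigma_smul_re hB _) hz) ξ
  simpa only [orbit, Nat.cast_mul, E_natCast_mul, transpose_pow] using h

/-- By the semigroup law, the `k`-th term is the integral over `[k, k + 1]`; the part from `n` to
`t` is nonnegative. -/
lemma sum_quadForm_C_orbit_le {A : Matrix (Fin N) (Fin N) ℝ} (hA : A.PosSemidef)
    (B : Matrix (Fin N) (Fin N) ℝ) {n : ℕ} {t : ℝ} (hn : n ≤ t)
    (ξ : EuclideanSpace ℝ (Fin N)) :
    ∑ k ∈ Finset.range n, quadForm (C A B 1) (orbit B ξ k) ≤ quadForm (C A B t) ξ := by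
  have hint : ∀ a b, IntervalIntegrable (fun s => quadForm A (orbit B ξ s))
      MeasureTheory.volume a b := (continuous_quadForm_orbit A B ξ).intervalIntegrable
  have hstep : ∀ k : ℕ, quadForm (C A B 1) (orbit B ξ k) =
      ∫ s in (k : ℝ)..((k + 1 : ℕ) : ℝ), quadForm A (orbit B ξ s) := by
    intro k
    simp only [quadForm_C, orbit_orbit]
    rw [intervalIntegral.integral_comp_add_left (fun s => quadForm A (orbit B ξ s))]
    simp
  simp only [hstep]
  rw [intervalIntegral.sum_integral_adjacent_intervals fun k _ => hint _ _, quadForm_C,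
    Nat.cast_zero]
  exact intervalIntegral.integral_mono_interval le_rfl (Nat.cast_nonneg n) hn
    (Filter.Eventually.of_forall fun s => quadForm_nonneg hA _) (hint _ _)

/-- Linear growth of the Kalman form when the spectrum of `B` is purely imaginary. -/
lemma exists_linear_growth_quadForm_C {A B : Matrix (Fin N) (Fin N) ℝ} (hA : A.PosSemidef)
    (hC : ∀ ξ ≠ 0, 0 < quadForm (C A B 1) ξ) (hB : ∀ z ∈ sigma B, z.re = 0) :
    ∃ c : ℝ, 0 < c ∧ ∀ t : ℝ, 1 ≤ t → ∀ ξ, c * t * ‖ξ‖ ^ 2 ≤ quadForm (C A B t) ξ := by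
  -- For `N = 0` the constant `L` below would vanish.
  rcases Nat.eq_zero_or_pos N with rfl | hN
  · refine ⟨1, one_pos, fun t _ ξ => ?_⟩
    simp [Subsingleton.elim ξ 0, quadForm]
  obtain ⟨l, hl, hcoer⟩ := exists_le_quadForm hC
  set K : ℝ := (2 ^ N) ^ 2 * N
  have hK : 0 ≤ K := by positivity
  set L : ℝ := N * (K * N + 1)
  have hL : 0 < L := by positivity
  refine ⟨l / (2 * L), by positivity, fun t ht ξ => ?_⟩
  have hn : (⌊t⌋₊ : ℝ) ≤ t := Nat.floor_le (by linarith)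
  have htn : t ≤ 2 * ⌊t⌋₊ := by
    have h1 : (1 : ℝ) ≤ ⌊t⌋₊ := by exact_mod_cast Nat.one_le_floor_iff t |>.2 ht
    linarith [Nat.lt_floor_add_one t]
  have havg : ⌊t⌋₊ * ‖ξ‖ ^ 2 ≤ L * ∑ k ∈ Finset.range ⌊t⌋₊, ‖orbit B ξ k‖ ^ 2 := by
    have := natCast_mul_le_sum_range (F := fun k => ‖orbit B ξ k‖ ^ 2) (fun k => by positivity)
      hK hN (fun q => by simpa [orbit_zero] using norm_sq_le_sum_orbit_natCast hB ξ q) ⌊t⌋₊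
    simpa [orbit_zero] using this
  calc l / (2 * L) * t * ‖ξ‖ ^ 2 ≤ l / (2 * L) * (2 * ⌊t⌋₊) * ‖ξ‖ ^ 2 := by gcongr
    _ = l / L * (⌊t⌋₊ * ‖ξ‖ ^ 2) := by field_simp
    _ ≤ l / L * (L * ∑ k ∈ Finset.range ⌊t⌋₊, ‖orbit B ξ k‖ ^ 2) := by gcongr
    _ = ∑ k ∈ Finset.range ⌊t⌋₊, l * ‖orbit B ξ k‖ ^ 2 := by
      rw [← Finset.mul_sum]; field_simp
    _ ≤ ∑ k ∈ Finset.range ⌊t⌋₊, quadForm (C A B 1) (orbit B ξ k) :=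
      Finset.sum_le_sum fun k _ => hcoer _
    _ ≤ quadForm (C A B t) ξ := sum_quadForm_C_orbit_le hA B hn ξ

/-- Positivity survives conjugation because `E(-t)ᵀ` is injective, with inverse `E(t)ᵀ`. -/
lemma quadForm_C_neg_pos {A B : Matrix (Fin N) (Fin N) ℝ} {t : ℝ} (hC : (C A B t).PosDef)
    {ξ : EuclideanSpace ℝ (Fin N)} (hξ : ξ ≠ 0) : 0 < quadForm (C A (-B) t) ξ := by
  rw [← quadForm_conj_C, quadForm_conj]
  refine quadForm_pos hC fun h => hξ ?_
  have h' : orbit B ξ (-t) = 0 := h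
  have := orbit_orbit B ξ (-t) t
  rw [h', neg_add_cancel, orbit_zero] at this
  rw [← this, orbit, map_zero]

end OrnsteinUhlenbeck

end

theorem proposition3p1 {N : ℕ} (A B : Matrix (Fin N) (Fin N) ℝ)
    (hA : A.PosSemidef)
    (hC : ∀ t : ℝ, 0 < t → (OrnsteinUhlenbeck.C A B t).PosDef)
    (hB : ∀ z ∈ OrnsteinUhlenbeck.sigma B, z.re = 0) :
    ∃ c_plus c_minus : ℝ, 0 < c_plus ∧ 0 < c_minus ∧
      ∀ t : ℝ, 1 ≤ t →
        (∀ ξ : EuclideanSpace ℝ (Fin N),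
          c_plus * t * ‖ξ‖ ^ 2 ≤
            OrnsteinUhlenbeck.quadForm
              (OrnsteinUhlenbeck.E B (-t) * OrnsteinUhlenbeck.C A B t *
                (OrnsteinUhlenbeck.E B (-t)).transpose) ξ) ∧
        (∀ ξ : EuclideanSpace ℝ (Fin N),
          c_minus * t * ‖ξ‖ ^ 2 ≤
            OrnsteinUhlenbeck.quadForm (OrnsteinUhlenbeck.C A B t) ξ) := by
  have hB' : ∀ z ∈ OrnsteinUhlenbeck.sigma (-B), z.re = 0 := by
    simpa using OrnsteinUhlenbeck.sigma_smul_re hB (-1)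
  obtain ⟨c, hc, h⟩ := OrnsteinUhlenbeck.exists_linear_growth_quadForm_C hA
    (fun ξ hξ => OrnsteinUhlenbeck.quadForm_pos (hC 1 one_pos) hξ) hB
  obtain ⟨c', hc', h'⟩ := OrnsteinUhlenbeck.exists_linear_growth_quadForm_C hA
    (fun ξ hξ => OrnsteinUhlenbeck.quadForm_C_neg_pos (hC 1 one_pos) hξ) hB'
  refine ⟨c', c, hc', hc, fun t ht => ⟨fun ξ => ?_, h t ht⟩⟩
  rw [OrnsteinUhlenbeck.quadForm_conj_C]
  exact h' t ht ξ
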